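/- Let $q$ be a prime power and let $n,m$ be integers with $2\le n\le m$. The rank $\mathrm{rk}(v)$ of a vector $v\in\mathbb{F}_{q^m}^n$ is the dimension over $\mathbb{F}_q$ of the $\mathbb{F}_q$-span of its entries. Let $\mathscr{L}=\mathscr{L}_{n-1}(n,m;q)$ be the set of all $\mathbb{F}_{q^m}$-subspaces of $\mathbb{F}_{q^m}^n$ of the form $\langle v_1,\dots,v_\ell\rangle_{\mathbb{F}_{q^m}}$ with $\ell\ge 1$ and $\mathrm{rk}(v_k)\le n-1$ for all $k$, ordered by inclusion; it is a finite graded lattice with minimum $0$, whose rank function $\rho$ is the $\mathbb{F}_{q^m}$-dimension. Let $\mu$ be its Möbius function, let $$w_j=\sum_{X\in\mathscr{L},\ \rho(X)=j}\mu(0,X),\qquad W_j=|\{X\in\mathscr{L}:\rho(X)=j\}|$$ be its Whitney numbers of the first and of the second kind, and for integers $0\le b\le a$ and $Q\ge 2$ let $\binom{a}{b}_{Q}=\prod_{i=0}^{b-1}\frac{Q^{a-i}-1}{Q^{i+1}-1}$. Then: 1. $w_0=1$. 2. For all $j\in\{1,\dots,n\}$, $$w_j=(-1)^j\left(q^{m\binom{j}{2}}\binom{n}{j}_{q^m}-q^{m\binom{j-1}{2}}\binom{n-1}{j-1}_{q^m}\prod_{s=1}^{n-1}(q^m-q^s)\right).$$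 3. $W_0=1$. 4. $W_1=\binom{n}{1}_{q^m}-\prod_{s=1}^{n-1}(q^m-q^s)$. 5. $W_j=\binom{n}{j}_{q^m}$ for all $j\in\{2,\dots,n\}$. -/

import Mathlib

/-- The rank (weight) of a vector `v ∈ Lⁿ` over the subfield `K`: the `K`-dimension of the
`K`-span of its entries. -/
noncomputable def vectorRank (K : Type*) {L : Type*} [Field K] [Field L] [Algebra K L] {n : ℕ}
    (v : Fin n → L) : ℕ :=
  Module.finrank K (Submodule.span K (Set.range v))

/-- The rank-metric lattice `𝓛_i(n,m;q)`, where `K = 𝔽_q` and `L = 𝔽_{q^m}`: the `L`-subspaces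
of `Lⁿ` of the form `⟨v₁, …, v_ℓ⟩` with `ℓ ≥ 1` and every `v_k` of rank at most `i`. -/
def RankMetricLattice (K L : Type*) [Field K] [Field L] [Algebra K L] (i n : ℕ) : Type _ :=
  {X : Submodule L (Fin n → L) //
    ∃ ℓ : ℕ, 1 ≤ ℓ ∧ ∃ v : Fin ℓ → Fin n → L,
      (∀ k, vectorRank K (v k) ≤ i) ∧ X = Submodule.span L (Set.range v)}

namespace RankMetricLattice

variable {K L : Type*} [Field K] [Field L] [Algebra K L] {i n : ℕ}

/-- The order is inclusion of subspaces. -/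
instance : PartialOrder (RankMetricLattice K L i n) :=
  Subtype.partialOrder _

noncomputable instance : OrderBot (RankMetricLattice K L i n) where
  bot := ⟨⊥, 1, le_rfl, fun _ => 0, fun _ => by
    have h : Submodule.span K (Set.range (0 : Fin n → L)) = ⊥ := by
      rw [Submodule.span_eq_bot]
      rintro _ ⟨_, rfl⟩
      rfl
    rw [vectorRank, h, finrank_bot]
    exact Nat.zero_le i, by simp⟩
  bot_le X := (bot_le : (⊥ : Submodule L (Fin n → L)) ≤ X.1)

/-- The poset is graded, with rank function the `L`-dimension. -/
noncomputable instance : GradeMinOrder ℕ (RankMetricLattice K L i n) where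
  grade X := Module.finrank L X.1
  grade_strictMono _ _ h := Submodule.finrank_lt_finrank_of_lt h
  covBy_grade := by
    rintro X Y hXY
    have hlt : X.1 < Y.1 := hXY.1
    obtain ⟨ℓ, hℓ, v, hv, hY⟩ := Y.2
    obtain ⟨k, hk⟩ : ∃ k, v k ∉ X.1 := by
      by_contra! h
      refine hlt.not_ge ?_
      rw [hY, Submodule.span_le]
      rintro _ ⟨k, rfl⟩
      exact h k
    obtain ⟨ℓ', hℓ', u, hu, hX⟩ := X.2
    let Z : RankMetricLattice K L i n :=
      ⟨Submodule.span L {v k} ⊔ X.1, ℓ' + 1, by omega, Fin.cons (v k) u,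
        fun j => by
          refine Fin.cases ?_ (fun j => ?_) j
          · simpa using hv k
          · simpa using hu j,
        by rw [Fin.range_cons, Submodule.span_insert, ← hX]⟩
    have hZ : X < Z := by
      refine lt_of_le_of_ne (le_sup_right : X.1 ≤ Submodule.span L {v k} ⊔ X.1) fun h => hk ?_
      have h' : X.1 = Submodule.span L {v k} ⊔ X.1 := congrArg Subtype.val h
      rw [h']
      exact Submodule.mem_sup_left (Submodule.mem_span_singleton_self _)
    have hvY : Submodule.span L {v k} ≤ Y.1 := by
      rw [hY]
      exact Submodule.span_mono (by rintro _ rfl; exact ⟨k, rfl⟩)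
    have hZY : Z = Y := by
      by_contra hne
      exact hXY.2 hZ (lt_of_le_of_ne (sup_le hvY hlt.le : Z.1 ≤ Y.1) hne)
    have hdim : Module.finrank L Y.1 ≤ Module.finrank L X.1 + 1 := by
      rw [← hZY]
      have h1 := Submodule.finrank_add_le_finrank_add_finrank (Submodule.span L {v k}) X.1
      have h2 := finrank_span_le_card (R := L) ({v k} : Set (Fin n → L))
      simp only [Set.toFinset_singleton, Finset.card_singleton] at h2
      change Module.finrank L ↥(Submodule.span L {v k} ⊔ X.1) ≤ _
      omega
    have := Submodule.finrank_lt_finrank_of_lt hlt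
    rw [Nat.covBy_iff_add_one_eq]
    omega
  isMin_grade := by
    intro X hX
    have h : X = ⊥ := le_antisymm (hX bot_le) bot_le
    subst h
    have : Module.finrank L (⊥ : Submodule L (Fin n → L)) = 0 := finrank_bot L _
    exact fun b _ => this.trans_le (Nat.zero_le b)

noncomputable instance [Finite L] : Fintype (RankMetricLattice K L i n) :=
  haveI : Finite (RankMetricLattice K L i n) := Subtype.finite
  Fintype.ofFinite _

open Classical in
noncomputable instance [Finite L] : LocallyFiniteOrder (RankMetricLattice K L i n) :=
  Fintype.toLocallyFiniteOrder

end RankMetricLattice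

open Classical in
/-- The `j`-th Whitney number of the first kind of a finite graded poset with minimum:
the sum of `μ(0, s)` over the elements `s` of rank `j`. -/
noncomputable def whitneyFirst (P : Type*) [PartialOrder P] [OrderBot P] [Fintype P]
    [LocallyFiniteOrder P] [GradeMinOrder ℕ P] (j : ℕ) : ℤ :=
  ∑ s : P with grade ℕ s = j, IncidenceAlgebra.mu ℤ (⊥ : P) s

/-- The `j`-th Whitney number of the second kind of a finite graded poset with minimum:
the number of elements of rank `j`. -/
noncomputable def whitneySecond (P : Type*) [PartialOrder P] [OrderBot P] [Fintype P]
    [GradeMinOrder ℕ P] (j : ℕ) : ℕ :=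
  Nat.card {s : P // grade ℕ s = j}

/-- The `Q`-binomial coefficient of natural numbers `a` and `b`. -/
def gaussianBinomial (Q a b : ℕ) : ℚ :=
  if a < b then 0 else ∏ i ∈ Finset.range b, ((Q : ℚ) ^ (a - i) - 1) / ((Q : ℚ) ^ (i + 1) - 1)

/-! Write `V` for `Lⁿ`. The lattice is the poset of all subspaces of `V` with the full-rank lines
removed (`exists_span_range_iff_not_isFullRankLine`). There are `∏_{s=1}^{n-1} (q^m - q^s)` such
lines (`card_isFullRankLine`), which gives the numbers of the second kind at once.

In the poset of all subspaces, `μ(A,B) = (-1)^d (q^m)^(d choose 2)` with `d = dim B - dim A`.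
Removing the antichain of full-rank lines `ℓ`, each with `μ(0,ℓ) = -1`, turns `μ(0,X)` into `μ(0,X)
+ ∑_{ℓ ≤ X} μ(ℓ,X)`. This is `rankMetricMobius`; it vanishes on the removed lines, so its sums may
run over all subspaces. Summing over dimension `j` and exchanging the order needs only the number of
`j`-dimensional subspaces, in `V` and above a given line. -/

section GaussianBinomial

/-! ### Gaussian binomial identities. -/

theorem gaussianBinomial_zero_right (Q a : ℕ) : gaussianBinomial Q a 0 = 1 := by
  simp [gaussianBinomial]

theorem gaussianBinomial_eq_zero_of_lt {Q a b : ℕ} (h : a < b) : gaussianBinomial Q a b = 0 :=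
  if_pos h

theorem pow_sub_one_ne_zero_of_two_le {Q : ℕ} (hQ : 2 ≤ Q) {i : ℕ} (hi : i ≠ 0) :
    (Q : ℚ) ^ i - 1 ≠ 0 := by
  have h : (1 : ℚ) < (Q : ℚ) ^ i := one_lt_pow₀ (by exact_mod_cast hQ) hi
  linarith

theorem gaussianBinomial_succ_right {Q a b : ℕ} (h : b ≤ a) :
    gaussianBinomial Q a (b + 1) =
      gaussianBinomial Q a b * (((Q : ℚ) ^ (a - b) - 1) / ((Q : ℚ) ^ (b + 1) - 1)) := by
  rcases h.lt_or_eq with h | rfl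
  · rw [gaussianBinomial, if_neg (by omega), gaussianBinomial, if_neg (by omega),
      Finset.prod_range_succ]
  · simp [gaussianBinomial]

theorem gaussianBinomial_succ_succ {Q a b : ℕ} (h : b ≤ a) :
    gaussianBinomial Q (a + 1) (b + 1) =
      gaussianBinomial Q a b * (((Q : ℚ) ^ (a + 1) - 1) / ((Q : ℚ) ^ (b + 1) - 1)) := by
  rw [gaussianBinomial, if_neg (by omega), gaussianBinomial, if_neg (by omega),
    Finset.prod_div_distrib, Finset.prod_div_distrib, Finset.prod_range_succ',
    Finset.prod_range_succ, div_mul_div_comm]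
  simp

/-- The `Q`-analogue of Pascal's rule. -/
theorem gaussianBinomial_pascal {Q : ℕ} (hQ : 2 ≤ Q) {a b : ℕ} (h : b ≤ a) :
    gaussianBinomial Q (a + 1) (b + 1) =
      gaussianBinomial Q a b + (Q : ℚ) ^ (b + 1) * gaussianBinomial Q a (b + 1) := by
  rw [gaussianBinomial_succ_succ h, gaussianBinomial_succ_right h]
  have h0 := pow_sub_one_ne_zero_of_two_le hQ b.succ_ne_zero
  have h1 : (Q : ℚ) ^ (a + 1) = (Q : ℚ) ^ (b + 1) * (Q : ℚ) ^ (a - b) := by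
    rw [← pow_add]; congr 1; omega
  rw [h1]
  simp only [Nat.succ_eq_add_one] at h0
  field_simp
  ring

/-- Pascal's rule makes the partial sums telescope. The range reaches `k = a + 1`, where the right
side vanishes. -/
theorem sum_range_gaussianBinomial {Q : ℕ} (hQ : 2 ≤ Q) {a k : ℕ} (hk : k ≤ a + 1) :
    ∑ i ∈ Finset.range (k + 1), (-1) ^ i * (Q : ℚ) ^ i.choose 2 * gaussianBinomial Q (a + 1) i =
      (-1) ^ k * (Q : ℚ) ^ (k + 1).choose 2 * gaussianBinomial Q a k := by
  induction k with
  | zero => simp [gaussianBinomial_zero_right]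
  | succ k ih =>
    rw [Finset.sum_range_succ, ih (by omega), gaussianBinomial_pascal hQ (by omega),
      Nat.choose_succ_succ' (k + 1) 1, Nat.choose_one_right, pow_add, pow_succ (-1 : ℚ)]
    ring

/-- The alternating sum of Gaussian binomial coefficients vanishes. -/
theorem sum_gaussianBinomial_eq_ite {Q : ℕ} (hQ : 2 ≤ Q) (a : ℕ) :
    ∑ i ∈ Finset.range (a + 1), (-1) ^ i * (Q : ℚ) ^ i.choose 2 * gaussianBinomial Q a i =
      if a = 0 then 1 else 0 := by
  cases a with
  | zero => simp [gaussianBinomial_zero_right]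
  | succ a =>
    rw [sum_range_gaussianBinomial hQ le_rfl, gaussianBinomial_eq_zero_of_lt a.lt_succ_self]
    simp

/-- Arithmetic form of the double count of independent `b`-tuples by their span. -/
theorem gaussianBinomial_mul_prod {Q : ℕ} (hQ : 2 ≤ Q) {a b : ℕ} (h : b ≤ a) :
    gaussianBinomial Q a b * ∏ i ∈ Finset.range b, ((Q : ℚ) ^ b - (Q : ℚ) ^ i) =
      ∏ i ∈ Finset.range b, ((Q : ℚ) ^ a - (Q : ℚ) ^ i) := by
  have key : ∀ c, b ≤ c → ∏ i ∈ Finset.range b, ((Q : ℚ) ^ c - (Q : ℚ) ^ i) =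
      (∏ i ∈ Finset.range b, (Q : ℚ) ^ i) * ∏ i ∈ Finset.range b, ((Q : ℚ) ^ (c - i) - 1) := by
    intro c hc
    rw [← Finset.prod_mul_distrib]
    refine Finset.prod_congr rfl fun i hi => ?_
    have := Finset.mem_range.1 hi
    rw [mul_sub, ← pow_add, mul_one]
    congr 2
    omega
  have hrefl : ∏ i ∈ Finset.range b, ((Q : ℚ) ^ (b - i) - 1) =
      ∏ i ∈ Finset.range b, ((Q : ℚ) ^ (i + 1) - 1) := by
    rw [← Finset.prod_range_reflect]
    refine Finset.prod_congr rfl fun i hi => ?_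
    have := Finset.mem_range.1 hi
    congr 2
    omega
  have hne : ∏ i ∈ Finset.range b, ((Q : ℚ) ^ (i + 1) - 1) ≠ 0 :=
    Finset.prod_ne_zero_iff.2 fun i _ => pow_sub_one_ne_zero_of_two_le hQ i.succ_ne_zero
  rw [key b le_rfl, key a h, hrefl, gaussianBinomial, if_neg (by omega), Finset.prod_div_distrib]
  field_simp

end GaussianBinomial

/-! ### Counting subspaces and Möbius sums over intervals. -/

section SubspaceCounting

variable {F V : Type*} [Field F] [AddCommGroup V] [Module F V]

/-- A linearly independent `k`-tuple is the same as a `k`-dimensional subspace together with a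
linearly independent `k`-tuple of it. -/
noncomputable def linearIndependentEquivSigma [FiniteDimensional F V] (k : ℕ) :
    {s : Fin k → V // LinearIndependent F s} ≃
      Σ W : {W : Submodule F V // Module.finrank F W = k},
        {s : Fin k → W.1 // LinearIndependent F s} where
  toFun s := ⟨⟨Submodule.span F (Set.range s.1), by simpa using finrank_span_eq_card s.2⟩,
    ⟨fun i => ⟨s.1 i, Submodule.subset_span ⟨i, rfl⟩⟩, linearIndependent_span s.2⟩⟩
  invFun p := ⟨fun i => (p.2.1 i : V), p.2.2.map' p.1.1.subtype p.1.1.ker_subtype⟩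
  left_inv s := rfl
  right_inv := by
    rintro ⟨⟨W, hW⟩, s, hs⟩
    have hspan : Submodule.span F (Set.range fun i => (s i : V)) = W := by
      have htop := hs.span_eq_top_of_card_eq_finrank' (by simp [hW])
      have := congrArg (Submodule.map W.subtype) htop
      rwa [Submodule.map_span, Submodule.map_subtype_top, ← Set.range_comp] at this
    -- With `U` a variable, `U = W` can be substituted, which avoids a heterogeneous equality of
    -- tuples.
    have key : ∀ (U : Submodule F V) (hU : Module.finrank F U = k) (t : Fin k → U)
        (ht : LinearIndependent F t), U = W → (∀ i, (t i : V) = s i) →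
        (⟨⟨U, hU⟩, t, ht⟩ : Σ W : {W : Submodule F V // Module.finrank F W = k},
          {s : Fin k → W.1 // LinearIndependent F s}) = ⟨⟨W, hW⟩, s, hs⟩ := by
      rintro U hU t ht rfl hts
      obtain rfl : t = s := funext fun i => Subtype.ext (hts i)
      rfl
    exact key _ _ _ _ hspan fun i => rfl

theorem card_linearIndependent_cast [Finite F] [Finite V] {k : ℕ} (hk : k ≤ Module.finrank F V) :
    (Nat.card {s : Fin k → V // LinearIndependent F s} : ℚ) =
      ∏ i ∈ Finset.range k,
        ((Nat.card F : ℚ) ^ Module.finrank F V - (Nat.card F : ℚ) ^ i) := by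
  have := Fintype.ofFinite F
  rw [card_linearIndependent hk, Finset.prod_range, Nat.cast_prod, Nat.card_eq_fintype_card]
  refine Finset.prod_congr rfl fun i _ => ?_
  rw [Nat.cast_sub (Nat.pow_le_pow_right Fintype.card_pos (by omega))]
  simp

/-- Count independent `k`-tuples by their span and cancel the number of ordered bases of a
`k`-dimensional space. -/
theorem card_submodule_finrank_eq [Finite F] [Finite V] (k : ℕ) :
    (Nat.card {W : Submodule F V // Module.finrank F W = k} : ℚ) =
      gaussianBinomial (Nat.card F) (Module.finrank F V) k := by
  rcases lt_or_ge (Module.finrank F V) k with h | h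
  · rw [gaussianBinomial_eq_zero_of_lt h, Nat.cast_eq_zero]
    have : IsEmpty {W : Submodule F V // Module.finrank F W = k} :=
      ⟨fun W => (W.2 ▸ Submodule.finrank_le W.1).not_gt h⟩
    simp
  have hQ : 2 ≤ Nat.card F := Finite.one_lt_card
  have hcard := Nat.card_congr (linearIndependentEquivSigma (F := F) (V := V) k)
  have := Fintype.ofFinite {W : Submodule F V // Module.finrank F W = k}
  rw [Nat.card_sigma] at hcard
  replace hcard := congrArg (Nat.cast : ℕ → ℚ) hcard
  rw [card_linearIndependent_cast h, Nat.cast_sum, Finset.sum_congr rfl (fun W _ => by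
    rw [card_linearIndependent_cast W.2.ge, W.2]), Finset.sum_const, Finset.card_univ,
    nsmul_eq_mul, ← gaussianBinomial_mul_prod hQ h, ← Nat.card_eq_fintype_card] at hcard
  refine (mul_right_cancel₀ (Finset.prod_ne_zero_iff.2 fun i hi => ?_) hcard).symm
  have hlt : (Nat.card F : ℚ) ^ i < (Nat.card F : ℚ) ^ k :=
    pow_lt_pow_right₀ (by exact_mod_cast hQ) (Finset.mem_range.1 hi)
  linarith

theorem finrank_comap_mkQ [FiniteDimensional F V] (A : Submodule F V) (S : Submodule F (V ⧸ A)) :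
    Module.finrank F (S.comap A.mkQ) = Module.finrank F A + Module.finrank F S := by
  have h := LinearMap.finrank_range_add_finrank_ker (A.mkQ.domRestrict (S.comap A.mkQ))
  rw [LinearMap.range_domRestrict, Submodule.map_comap_eq_of_surjective A.mkQ_surjective,
    LinearMap.ker_domRestrict, Submodule.ker_mkQ] at h
  rw [← h, add_comm]
  congr 1
  exact (Submodule.submoduleOfEquivOfLe (Submodule.le_comap_mkQ A S)).finrank_eq

/-- The subspaces between `A` and `B` correspond to the subspaces of `B ⧸ A`. -/
theorem exists_equiv_submodule_quotient [FiniteDimensional F V] {A B : Submodule F V}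
    (h : A ≤ B) :
    ∃ e : Submodule F (B ⧸ A.submoduleOf B) ≃ {Y : Submodule F V // A ≤ Y ∧ Y ≤ B},
      ∀ S, Module.finrank F (e S).1 = Module.finrank F A + Module.finrank F S := by
  refine ⟨⟨fun S => ⟨(S.comap (A.submoduleOf B).mkQ).map B.subtype, ?_, Submodule.map_subtype_le _ _⟩,
    fun Y => (Y.1.comap B.subtype).map (A.submoduleOf B).mkQ, fun S => ?_, fun Y => ?_⟩, fun S => ?_⟩
  · intro x hx
    exact ⟨⟨x, h hx⟩, Submodule.le_comap_mkQ _ S hx, rfl⟩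
  · simp only [Submodule.comap_map_eq_of_injective B.subtype_injective]
    exact Submodule.map_comap_eq_of_surjective (Submodule.mkQ_surjective _) S
  · refine Subtype.ext ?_
    have hA : A.submoduleOf B ≤ Y.1.comap B.subtype := Submodule.comap_mono Y.2.1
    simp only [Submodule.comap_map_mkQ, sup_eq_right.2 hA, Submodule.map_comap_subtype]
    exact inf_eq_right.2 Y.2.2
  · change Module.finrank F ((S.comap (A.submoduleOf B).mkQ).map B.subtype) = _
    rw [Submodule.finrank_map_subtype_eq, finrank_comap_mkQ,
      (Submodule.submoduleOfEquivOfLe h).finrank_eq]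

theorem finrank_quotient_submoduleOf [FiniteDimensional F V] {A B : Submodule F V} (h : A ≤ B) :
    Module.finrank F (B ⧸ A.submoduleOf B) = Module.finrank F B - Module.finrank F A := by
  rw [Submodule.finrank_quotient, (Submodule.submoduleOfEquivOfLe h).finrank_eq]

theorem card_submodule_between_finrank_eq [Finite F] [Finite V] {A B : Submodule F V}
    (h : A ≤ B) (k : ℕ) :
    (Nat.card {Y : Submodule F V //
        (A ≤ Y ∧ Y ≤ B) ∧ Module.finrank F Y = Module.finrank F A + k} : ℚ) =
      gaussianBinomial (Nat.card F) (Module.finrank F B - Module.finrank F A) k := by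
  obtain ⟨e, he⟩ := exists_equiv_submodule_quotient h
  have : Finite (B ⧸ A.submoduleOf B) := Quotient.finite _
  rw [← finrank_quotient_submoduleOf h, ← card_submodule_finrank_eq, Nat.cast_inj]
  refine (Nat.card_congr ((e.subtypeEquiv fun S => ?_).trans
    (Equiv.subtypeSubtypeEquivSubtypeInter _
      fun Y : Submodule F V => Module.finrank F Y = Module.finrank F A + k))).symm
  rw [he, Nat.add_left_cancel_iff]

/-- The Möbius sum over an interval of the lattice of subspaces. -/
theorem sum_submodule_between [Finite F] [Finite V] [Fintype (Submodule F V)]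
    [DecidableLE (Submodule F V)] [DecidableEq (Submodule F V)] {A B : Submodule F V} (h : A ≤ B) :
    ∑ Y : Submodule F V with A ≤ Y ∧ Y ≤ B,
        (-1 : ℚ) ^ (Module.finrank F Y - Module.finrank F A) *
          (Nat.card F : ℚ) ^ (Module.finrank F Y - Module.finrank F A).choose 2 =
      if A = B then 1 else 0 := by
  have hQ : 2 ≤ Nat.card F := Finite.one_lt_card
  have hAB : A = B ↔ Module.finrank F B - Module.finrank F A = 0 := by
    constructor
    · rintro rfl
      simp
    · intro h0
      exact Submodule.eq_of_le_of_finrank_le h (by omega)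
  -- The indicator becomes the alternating Gaussian sum, to be matched term by term after grouping
  -- `Y` by its dimension over `A`.
  simp only [hAB, ← sum_gaussianBinomial_eq_ite hQ]
  rw [← Finset.sum_fiberwise_of_maps_to (t := Finset.range _)
    (g := fun Y : Submodule F V => Module.finrank F Y - Module.finrank F A)]
  · refine Finset.sum_congr rfl fun k _ => ?_
    rw [Finset.sum_congr rfl (g := fun _ => (-1 : ℚ) ^ k * (Nat.card F : ℚ) ^ k.choose 2)
      (fun Y hY => by rw [(Finset.mem_filter.1 hY).2]), Finset.sum_const, nsmul_eq_mul, mul_comm,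
      ← card_submodule_between_finrank_eq h, Finset.filter_filter]
    congr 2
    refine (Nat.subtype_card _ fun Y => ?_).symm
    simp only [Finset.mem_filter, Finset.mem_univ, true_and, and_congr_right_iff]
    intro hY
    have := Submodule.finrank_mono hY.1
    omega
  · intro Y hY
    have := Submodule.finrank_mono (Finset.mem_filter.1 hY).2.2
    rw [Finset.mem_range]
    omega

end SubspaceCounting

/-- The values of the Möbius function at `a` are determined by its defining sums. -/
theorem IncidenceAlgebra.mu_eq_of_sum_Icc {α R : Type*} [PartialOrder α] [LocallyFiniteOrder α]
    [DecidableEq α] [WellFoundedLT α] [Ring R] (a : α) (f : α → R)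
    (h : ∀ b, a ≤ b → ∑ x ∈ Finset.Icc a b, f x = if a = b then 1 else 0) (b : α) (hab : a ≤ b) :
    (IncidenceAlgebra.mu ℤ a b : R) = f b := by
  induction b using WellFoundedLT.induction with
  | ind b ih =>
    have h1 := congrArg (Int.cast : ℤ → R) (IncidenceAlgebra.sum_Icc_mu_right (𝕜 := ℤ) a b)
    have h2 := h b hab
    rw [Int.cast_sum, Finset.Icc_eq_cons_Ico hab, Finset.sum_cons, Finset.sum_congr rfl
      fun x hx => ih x (Finset.mem_Ico.1 hx).2 (Finset.mem_Ico.1 hx).1] at h1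
    rw [Finset.Icc_eq_cons_Ico hab, Finset.sum_cons] at h2
    -- By induction both sums share the part over `Ico a b`.
    refine add_right_cancel (h1.trans ?_)
    rw [h2]
    split_ifs <;> simp

/-! ### Full-rank lines. -/

section FullRank

variable {K L : Type*} [Field K] [Field L] [Algebra K L] {n : ℕ}

theorem vectorRank_le_sub_one_iff (hn : 1 ≤ n) (v : Fin n → L) :
    vectorRank K v ≤ n - 1 ↔ ¬ LinearIndependent K v := by
  rw [linearIndependent_iff_card_le_finrank_span, Fintype.card_fin, Set.finrank, vectorRank]
  omega

/-- Multiplication by `c` is an injective `K`-linear map of `L`. Hence having full rank depends only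
on the `L`-line of a vector. -/
theorem linearIndependent_smul_iff {c : L} (hc : c ≠ 0) {v : Fin n → L} :
    LinearIndependent K (c • v) ↔ LinearIndependent K v :=
  LinearMap.linearIndependent_iff (LinearMap.mulLeft K c)
    (LinearMap.ker_eq_bot.2 (mul_right_injective₀ hc)) (v := v)

theorem LinearIndependent.vector_ne_zero (hn : 1 ≤ n) {v : Fin n → L}
    (hv : LinearIndependent K v) : v ≠ 0 := fun h =>
  hv.ne_zero ⟨0, hn⟩ (congrFun h _)

variable (K) in
/-- The lines of `Lⁿ` spanned by a vector of maximal rank. -/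
def IsFullRankLine (X : Submodule L (Fin n → L)) : Prop :=
  ∃ v : Fin n → L, LinearIndependent K v ∧ Submodule.span L {v} = X

theorem IsFullRankLine.finrank_eq (hn : 1 ≤ n) {X : Submodule L (Fin n → L)}
    (hX : IsFullRankLine K X) : Module.finrank L X = 1 := by
  obtain ⟨v, hv, rfl⟩ := hX
  exact finrank_span_singleton (hv.vector_ne_zero hn)

/-- A subspace that is not spanned by its vectors of non-maximal rank is a line spanned by a
vector of maximal rank. -/
theorem le_span_of_not_isFullRankLine (hn : 1 ≤ n) {X : Submodule L (Fin n → L)}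
    (hX : ¬ IsFullRankLine K X) :
    X ≤ Submodule.span L {v | v ∈ X ∧ vectorRank K v ≤ n - 1} := by
  set S := Submodule.span L {v | v ∈ X ∧ vectorRank K v ≤ n - 1} with hS
  intro v hv
  by_contra hvS
  -- A zero entry forces rank below `n`, so a vector `v` of `X` outside `S` has no zero entry and
  -- can be used to clear any coordinate of another vector.
  have hmem : ∀ w ∈ X, ∀ i, w i = 0 → w ∈ S := fun w hw i hi =>
    Submodule.subset_span ⟨hw, (vectorRank_le_sub_one_iff hn w).2 fun h => h.ne_zero i hi⟩
  have hv0 : ∀ i, v i ≠ 0 := fun i hi => hvS (hmem v hv i hi)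
  refine hX ⟨v, ?_, le_antisymm ((Submodule.span_singleton_le_iff_mem _ _).2 hv) fun w hw => ?_⟩
  · by_contra h
    exact hvS (Submodule.subset_span ⟨hv, (vectorRank_le_sub_one_iff hn v).2 h⟩)
  have hsub : ∀ i, w - (w i / v i) • v ∈ S := fun i =>
    hmem _ (X.sub_mem hw (X.smul_mem _ hv)) i (by simp [hv0 i])
  -- Subtracting two of the vectors in `hsub` leaves a multiple of `v` in `S`; as `v ∉ S`, its
  -- coefficient is zero, so `w` is proportional to `v`.
  have hratio : ∀ i, w i / v i = w ⟨0, hn⟩ / v ⟨0, hn⟩ := by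
    intro i
    by_contra hne
    have h := S.sub_mem (hsub ⟨0, hn⟩) (hsub i)
    rw [sub_sub_sub_cancel_left, ← sub_smul] at h
    exact hvS ((S.smul_mem_iff (sub_ne_zero.2 hne)).1 h)
  refine Submodule.mem_span_singleton.2 ⟨w ⟨0, hn⟩ / v ⟨0, hn⟩, funext fun i => ?_⟩
  rw [Pi.smul_apply, smul_eq_mul, ← hratio i, div_mul_cancel₀ _ (hv0 i)]

/-- Membership in the lattice generated by the vectors of non-maximal rank. -/
theorem exists_span_range_iff_not_isFullRankLine [Finite L] (hn : 1 ≤ n)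
    (X : Submodule L (Fin n → L)) :
    (∃ ℓ : ℕ, 1 ≤ ℓ ∧ ∃ v : Fin ℓ → Fin n → L,
      (∀ k, vectorRank K (v k) ≤ n - 1) ∧ X = Submodule.span L (Set.range v)) ↔
      ¬ IsFullRankLine K X := by
  constructor
  · rintro ⟨ℓ, -, v, hv, hX⟩ ⟨w, hw, hwX⟩
    -- Every nonzero vector of a full-rank line has full rank, so low-rank generators inside it are
    -- zero.
    have hzero : ∀ k, v k = 0 := by
      intro k
      have hk : v k ∈ Submodule.span L {w} := by
        rw [hwX, hX]
        exact Submodule.subset_span ⟨k, rfl⟩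
      obtain ⟨c, hc⟩ := Submodule.mem_span_singleton.1 hk
      by_contra hne
      have hc0 : c ≠ 0 := by
        rintro rfl
        exact hne (by rw [← hc, zero_smul])
      refine (vectorRank_le_sub_one_iff hn _).1 (hv k) ?_
      rw [← hc]
      exact (linearIndependent_smul_iff hc0).2 hw
    have hbot : X = ⊥ := by
      rw [hX, Submodule.span_eq_bot]
      rintro _ ⟨k, rfl⟩
      exact hzero k
    rw [hbot, Submodule.span_singleton_eq_bot] at hwX
    exact hw.vector_ne_zero hn hwX
  · intro hX
    let S : Set (Fin n → L) := {v | v ∈ X ∧ vectorRank K v ≤ n - 1}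
    have : Fintype S := Fintype.ofFinite S
    -- The zero vector ensures that the generating family is nonempty, as `1 ≤ ℓ` requires.
    have h0 : (0 : Fin n → L) ∈ S :=
      ⟨X.zero_mem, (vectorRank_le_sub_one_iff hn _).2 fun h => h.vector_ne_zero hn rfl⟩
    let e := Fintype.equivFin S
    refine ⟨Fintype.card S, Fintype.card_pos_iff.2 ⟨⟨0, h0⟩⟩, fun k => (e.symm k).1,
      fun k => (e.symm k).2.2, ?_⟩
    have hrange : Set.range (fun k => ((e.symm k : S) : Fin n → L)) = S := by
      rw [← Function.comp_def, e.symm.surjective.range_comp, Subtype.range_coe]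
    rw [hrange]
    exact le_antisymm (le_span_of_not_isFullRankLine hn hX) (Submodule.span_le.2 fun v hv => hv.1)

theorem card_linearIndependent_eq_card_isFullRankLine_mul [Finite L] (hn : 1 ≤ n) :
    Nat.card {v : Fin n → L // LinearIndependent K v} =
      Nat.card {X : Submodule L (Fin n → L) // IsFullRankLine K X} * (Nat.card L - 1) := by
  let f : {v : Fin n → L // LinearIndependent K v} →
      {X : Submodule L (Fin n → L) // IsFullRankLine K X} :=
    fun v => ⟨Submodule.span L {v.1}, v.1, v.2, rfl⟩
  -- The generators of a line form a single free orbit of `Lˣ`.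
  have hfib : ∀ X, Nat.card {v // f v = X} = Nat.card L - 1 := by
    rintro ⟨X, w, hw, hX⟩
    rw [← Nat.card_units]
    let g : Lˣ → {v // f v = ⟨X, w, hw, hX⟩} := fun c =>
      ⟨⟨c.1 • w, (linearIndependent_smul_iff c.ne_zero).2 hw⟩, Subtype.ext
        ((Submodule.span_singleton_group_smul_eq L c w).trans hX)⟩
    refine (Nat.card_congr (Equiv.ofBijective g ⟨fun c d hcd => ?_, fun v => ?_⟩)).symm
    · have h : c.1 • w = d.1 • w := congrArg (fun v => v.1.1) hcd
      exact Units.ext (smul_left_injective L (hw.vector_ne_zero hn) h)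
    · have h : Submodule.span L {w} = Submodule.span L {v.1.1} :=
        hX.trans (congrArg Subtype.val v.2).symm
      obtain ⟨c, hc⟩ := Submodule.span_singleton_eq_span_singleton.1 h
      exact ⟨c, Subtype.ext (Subtype.ext hc)⟩
  have := Fintype.ofFinite {X : Submodule L (Fin n → L) // IsFullRankLine K X}
  rw [Nat.card_congr (Equiv.sigmaFiberEquiv f).symm, Nat.card_sigma]
  simp [hfib]

/-- Full-rank vectors are the independent `n`-tuples of the `K`-space `L`. The factor `s = 0` of
their count is `q^m - 1`, the number of generators of a line, and cancels. -/
theorem card_isFullRankLine [Finite K] [Finite L] (hn : 1 ≤ n) (hnm : n ≤ Module.finrank K L) :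
    (Nat.card {X : Submodule L (Fin n → L) // IsFullRankLine K X} : ℚ) =
      ∏ s ∈ Finset.Icc 1 (n - 1),
        ((Nat.card K : ℚ) ^ Module.finrank K L - (Nat.card K : ℚ) ^ s) := by
  have h := congrArg (Nat.cast : ℕ → ℚ)
    (card_linearIndependent_eq_card_isFullRankLine_mul (K := K) (L := L) hn)
  have hL : 1 < Nat.card L := Finite.one_lt_card
  rw [card_linearIndependent_cast hnm, Finset.range_eq_Ico, Finset.prod_eq_prod_Ico_succ_bot hn,
    Nat.cast_mul, Nat.cast_sub hL.le, mul_comm, Module.natCard_eq_pow_finrank (K := K) (V := L),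
    Nat.cast_pow, pow_zero, Nat.cast_one, zero_add] at h
  have hne : (Nat.card K : ℚ) ^ Module.finrank K L - 1 ≠ 0 :=
    pow_sub_one_ne_zero_of_two_le Finite.one_lt_card (by omega)
  rw [← mul_right_cancel₀ hne h]
  refine Finset.prod_congr ?_ fun _ _ => rfl
  ext s
  simp only [Finset.mem_Ico, Finset.mem_Icc]
  omega

end FullRank

/-! ### Möbius function and Whitney numbers of the lattice. -/

section Whitney

variable {K L : Type*} [Field K] [Field L] [Algebra K L] {n : ℕ}

theorem IsFullRankLine.eq_of_le (hn : 1 ≤ n) {X Y : Submodule L (Fin n → L)}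
    (hX : IsFullRankLine K X) (hY : IsFullRankLine K Y) (h : X ≤ Y) : X = Y :=
  Submodule.eq_of_le_of_finrank_eq h ((hX.finrank_eq hn).trans (hY.finrank_eq hn).symm)

open Classical in
variable (K) in
/-- The Möbius function `μ(0, X)` of the rank-metric lattice, extended by zero to all subspaces. -/
noncomputable def rankMetricMobius [Fintype (Submodule L (Fin n → L))]
    (X : Submodule L (Fin n → L)) : ℚ :=
  (-1) ^ Module.finrank L X * (Nat.card L : ℚ) ^ (Module.finrank L X).choose 2 +
    ∑ _ℓ : Submodule L (Fin n → L) with IsFullRankLine K _ℓ ∧ _ℓ ≤ X,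
      (-1) ^ (Module.finrank L X - 1) * (Nat.card L : ℚ) ^ (Module.finrank L X - 1).choose 2

section Mobius

variable [Fintype (Submodule L (Fin n → L))]

/-- The only full-rank line below `X` is `X` itself, so the value is `-1 + 1`. -/
theorem rankMetricMobius_eq_zero (hn : 1 ≤ n) {X : Submodule L (Fin n → L)}
    (hX : IsFullRankLine K X) : rankMetricMobius K X = 0 := by
  classical
  have h : (Finset.univ.filter fun ℓ : Submodule L (Fin n → L) =>
      IsFullRankLine K ℓ ∧ ℓ ≤ X) = {X} := by
    ext ℓ
    simp only [Finset.mem_filter, Finset.mem_univ, true_and, Finset.mem_singleton]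
    exact ⟨fun h => h.1.eq_of_le hn hX h.2, by rintro rfl; exact ⟨hX, le_rfl⟩⟩
  rw [rankMetricMobius, h, Finset.sum_singleton, hX.finrank_eq hn]
  simp

open Classical in
-- After exchanging sums, each line `ℓ ≤ X` contributes the Möbius sum over `[ℓ, X]`, which is zero
-- because `ℓ ≠ X`. Only the sum over `[⊥, X]` remains.
theorem sum_rankMetricMobius_le [Finite L] (hn : 1 ≤ n) {X : Submodule L (Fin n → L)}
    (hX : ¬ IsFullRankLine K X) :
    ∑ Y : Submodule L (Fin n → L) with Y ≤ X, rankMetricMobius K Y = if ⊥ = X then 1 else 0 := by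
  simp only [rankMetricMobius]
  rw [Finset.sum_add_distrib]
  have h1 := sum_submodule_between (F := L) (bot_le : ⊥ ≤ X)
  simp only [bot_le, true_and, finrank_bot, Nat.sub_zero] at h1
  rw [h1, add_eq_left, Finset.sum_comm' (t' := Finset.univ.filter
    fun ℓ : Submodule L (Fin n → L) => IsFullRankLine K ℓ ∧ ℓ ≤ X)
    (s' := fun ℓ => Finset.univ.filter fun Y => ℓ ≤ Y ∧ Y ≤ X)]
  · refine Finset.sum_eq_zero fun ℓ hℓ => ?_
    obtain ⟨hline, hle⟩ := (Finset.mem_filter.1 hℓ).2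
    have h2 := sum_submodule_between (F := L) hle
    rw [hline.finrank_eq hn] at h2
    rw [h2, if_neg]
    rintro rfl
    exact hX hline
  · intro Y ℓ
    simp only [Finset.mem_filter, Finset.mem_univ, true_and]
    exact ⟨fun h => ⟨⟨h.2.2, h.1⟩, h.2.1, h.2.2.trans h.1⟩, fun h => ⟨h.1.2, h.2.1, h.1.1⟩⟩

open Classical in
theorem sum_rankMetricMobius_finrank [Finite L] (hn : 1 ≤ n) {j : ℕ} (hj : 1 ≤ j) :
    ∑ Y : Submodule L (Fin n → L) with Module.finrank L (Y : Submodule L (Fin n → L)) = j,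
        rankMetricMobius K Y =
      (-1) ^ j * ((Nat.card L : ℚ) ^ j.choose 2 * gaussianBinomial (Nat.card L) n j -
        (Nat.card L : ℚ) ^ (j - 1).choose 2 * gaussianBinomial (Nat.card L) (n - 1) (j - 1) *
          (Nat.card {X : Submodule L (Fin n → L) // IsFullRankLine K X} : ℚ)) := by
  have hcard := card_submodule_finrank_eq (F := L) (V := Fin n → L) j
  rw [Module.finrank_fin_fun, Nat.subtype_card (Finset.univ.filter
    fun Y : Submodule L (Fin n → L) => Module.finrank L Y = j) (by simp)] at hcard
  -- The `j`-dimensional subspaces above `ℓ` correspond to the `(j - 1)`-dimensional ones of the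
  -- quotient by `ℓ`.
  have habove : ∀ ℓ ∈ Finset.univ.filter
      (fun ℓ : Submodule L (Fin n → L) => IsFullRankLine K ℓ),
      ((Finset.univ.filter fun Y : Submodule L (Fin n → L) =>
        ℓ ≤ Y ∧ Module.finrank L Y = j).card : ℚ) =
      gaussianBinomial (Nat.card L) (n - 1) (j - 1) := by
    intro ℓ hℓ
    have h := card_submodule_between_finrank_eq (le_top : ℓ ≤ ⊤) (j - 1)
    rw [(Finset.mem_filter.1 hℓ).2.finrank_eq hn, finrank_top, Module.finrank_fin_fun] at h
    rw [← h, Nat.cast_inj]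
    refine (Nat.subtype_card _ fun Y => ?_).symm
    simp only [Finset.mem_filter, Finset.mem_univ, true_and, le_top, and_true,
      Nat.add_sub_cancel' hj]
  have hsum : ∀ Y ∈ Finset.univ.filter
      (fun Y : Submodule L (Fin n → L) => Module.finrank L Y = j),
      rankMetricMobius K Y = (-1) ^ j * (Nat.card L : ℚ) ^ j.choose 2 +
        ∑ _ℓ : Submodule L (Fin n → L) with IsFullRankLine K _ℓ ∧ _ℓ ≤ Y,
          (-1) ^ (j - 1) * (Nat.card L : ℚ) ^ (j - 1).choose 2 := by
    intro Y hY
    rw [rankMetricMobius, (Finset.mem_filter.1 hY).2]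
  rw [Finset.sum_congr rfl hsum, Finset.sum_add_distrib, Finset.sum_const, nsmul_eq_mul, hcard,
    Finset.sum_comm' (t' := Finset.univ.filter
      fun ℓ : Submodule L (Fin n → L) => IsFullRankLine K ℓ)
    (s' := fun ℓ => Finset.univ.filter fun Y => ℓ ≤ Y ∧ Module.finrank L Y = j)]
  · simp only [Finset.sum_const, nsmul_eq_mul]
    rw [Finset.sum_congr rfl fun ℓ hℓ => by rw [habove ℓ hℓ], Finset.sum_const, nsmul_eq_mul,
      Nat.subtype_card (Finset.univ.filter
        fun ℓ : Submodule L (Fin n → L) => IsFullRankLine K ℓ) (by simp)]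
    obtain ⟨i, rfl⟩ := Nat.exists_eq_add_of_le' hj
    rw [Nat.add_sub_cancel, pow_succ (-1 : ℚ)]
    ring
  · intro Y ℓ
    simp only [Finset.mem_filter, Finset.mem_univ, true_and]
    tauto

open Classical in
theorem RankMetricLattice.sum_filter_eq [Finite L] (hn : 1 ≤ n)
    (p : Submodule L (Fin n → L) → Prop) :
    ∑ X : RankMetricLattice K L (n - 1) n with p X.1, rankMetricMobius K X.1 =
      ∑ Y : Submodule L (Fin n → L) with p Y, rankMetricMobius K Y := by
  refine Finset.sum_of_injOn (fun X : RankMetricLattice K L (n - 1) n => X.1)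
    (fun X _ Y _ h => Subtype.ext h) (fun X hX => ?_) (fun Y hY hYX => ?_) (fun _ _ => rfl)
  · simpa using hX
  -- A subspace outside the lattice is a full-rank line, where the summand is zero.
  · by_contra hne
    have hY' : ¬ IsFullRankLine K Y := fun h => hne (rankMetricMobius_eq_zero hn h)
    exact hYX ⟨⟨Y, (exists_span_range_iff_not_isFullRankLine hn Y).2 hY'⟩,
      Finset.mem_coe.2 (Finset.mem_filter.2 ⟨Finset.mem_univ _, (Finset.mem_filter.1 hY).2⟩), rfl⟩

open Classical in
theorem RankMetricLattice.mu_bot_eq [Finite L] (hn : 1 ≤ n)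
    (X : RankMetricLattice K L (n - 1) n) :
    (IncidenceAlgebra.mu ℤ ⊥ X : ℚ) = rankMetricMobius K X.1 := by
  refine IncidenceAlgebra.mu_eq_of_sum_Icc (R := ℚ) ⊥
    (fun X : RankMetricLattice K L (n - 1) n => rankMetricMobius K X.1) (fun X _ => ?_) X bot_le
  have hX := (exists_span_range_iff_not_isFullRankLine hn X.1).1 X.2
  have hIcc : Finset.Icc ⊥ X = Finset.univ.filter
      fun Y : RankMetricLattice K L (n - 1) n => Y.1 ≤ X.1 := by
    ext Y
    simp only [Finset.mem_Icc, bot_le, true_and, Finset.mem_filter, Finset.mem_univ]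
    rfl
  rw [hIcc, RankMetricLattice.sum_filter_eq hn (· ≤ X.1), sum_rankMetricMobius_le hn hX]
  have hbot : (⊥ : Submodule L (Fin n → L)) = X.1 ↔ ⊥ = X :=
    (Subtype.ext_iff (a1 := (⊥ : RankMetricLattice K L (n - 1) n)) (a2 := X)).symm
  simp only [hbot]

end Mobius

theorem whitneyFirst_rankMetricLattice [Finite L] (hn : 1 ≤ n) {j : ℕ} (hj : 1 ≤ j) :
    (whitneyFirst (RankMetricLattice K L (n - 1) n) j : ℚ) =
      (-1) ^ j * ((Nat.card L : ℚ) ^ j.choose 2 * gaussianBinomial (Nat.card L) n j -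
        (Nat.card L : ℚ) ^ (j - 1).choose 2 * gaussianBinomial (Nat.card L) (n - 1) (j - 1) *
          (Nat.card {X : Submodule L (Fin n → L) // IsFullRankLine K X} : ℚ)) := by
  classical
  have := Fintype.ofFinite (Submodule L (Fin n → L))
  have h := RankMetricLattice.sum_filter_eq (K := K) hn
    fun Y : Submodule L (Fin n → L) => Module.finrank L Y = j
  rw [← sum_rankMetricMobius_finrank hn hj, whitneyFirst, Int.cast_sum]
  convert h using 2
  · ext X
    simp only [Finset.mem_filter, Finset.mem_univ, true_and]
    rfl
  · exact RankMetricLattice.mu_bot_eq hn _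
  · ext Y
    simp only [Finset.mem_filter]

theorem grade_eq_zero_iff_eq_bot {P : Type*} [PartialOrder P] [OrderBot P] [GradeMinOrder ℕ P]
    {s : P} : grade ℕ s = 0 ↔ s = ⊥ := by
  have hbot : grade ℕ (⊥ : P) = 0 := (isMin_bot.grade ℕ).eq_bot
  refine ⟨fun h => (bot_le.eq_or_lt.resolve_right fun hlt => ?_).symm, fun h => h ▸ hbot⟩
  have := grade_strictMono (𝕆 := ℕ) hlt
  omega

theorem whitneyFirst_zero {P : Type*} [PartialOrder P] [OrderBot P] [Fintype P]
    [LocallyFiniteOrder P] [GradeMinOrder ℕ P] : whitneyFirst P 0 = 1 := by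
  classical
  have h : (Finset.univ.filter fun s : P => grade ℕ s = 0) = {⊥} := by
    ext s
    simp only [Finset.mem_filter, Finset.mem_univ, true_and, Finset.mem_singleton]
    exact grade_eq_zero_iff_eq_bot
  rw [whitneyFirst]
  convert (IncidenceAlgebra.mu_self (𝕜 := ℤ) (⊥ : P))
  rw [← Finset.sum_singleton (fun s => IncidenceAlgebra.mu ℤ ⊥ s) (⊥ : P), ← h]

theorem whitneySecond_zero {P : Type*} [PartialOrder P] [OrderBot P] [Fintype P]
    [GradeMinOrder ℕ P] : whitneySecond P 0 = 1 := by
  rw [whitneySecond, Nat.card_congr (Equiv.subtypeEquivRight fun _ => grade_eq_zero_iff_eq_bot)]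
  exact Nat.card_unique

/-- The `j`-dimensional subspaces split into lattice elements and full-rank lines; the latter occur
only for `j = 1`. -/
theorem whitneySecond_rankMetricLattice [Finite L] (hn : 1 ≤ n) (j : ℕ) :
    (whitneySecond (RankMetricLattice K L (n - 1) n) j : ℚ) =
      gaussianBinomial (Nat.card L) n j -
        (Nat.card {X : Submodule L (Fin n → L) //
          Module.finrank L X = j ∧ IsFullRankLine K X} : ℚ) := by
  classical
  have hcard := card_submodule_finrank_eq (F := L) (V := Fin n → L) j
  rw [Module.finrank_fin_fun] at hcard
  rw [← hcard, eq_sub_iff_add_eq, ← Nat.cast_add, Nat.cast_inj, add_comm, ← Nat.card_congr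
    (Equiv.sumCompl fun Y : {Y : Submodule L (Fin n → L) // Module.finrank L Y = j} =>
      IsFullRankLine K Y.1), Nat.card_sum]
  congr 1
  · exact Nat.card_congr (Equiv.subtypeSubtypeEquivSubtypeInter
      (fun Y : Submodule L (Fin n → L) => Module.finrank L Y = j) (IsFullRankLine K)).symm
  · refine Nat.card_congr ((Equiv.subtypeSubtypeEquivSubtypeInter _
      fun Y : Submodule L (Fin n → L) => Module.finrank L Y = j).trans
      ((Equiv.subtypeEquivRight fun Y => ?_).trans
        (Equiv.subtypeSubtypeEquivSubtypeInter
          (fun Y : Submodule L (Fin n → L) => Module.finrank L Y = j)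
          fun Y => ¬ IsFullRankLine K Y).symm))
    rw [exists_span_range_iff_not_isFullRankLine hn, and_comm]

end Whitney

theorem mainTheorem9 {K L : Type*} [Field K] [Field L] [Algebra K L] [Finite K] [Finite L]
    (q n m : ℕ) (hq : Nat.card K = q) (hm : Module.finrank K L = m)
    (hn : 2 ≤ n) (hnm : n ≤ m) :
    whitneyFirst (RankMetricLattice K L (n - 1) n) 0 = 1 ∧
    (∀ j : ℕ, 1 ≤ j → j ≤ n →
      (whitneyFirst (RankMetricLattice K L (n - 1) n) j : ℚ) =
        (-1) ^ j * ((q : ℚ) ^ (m * j.choose 2) * gaussianBinomial (q ^ m) n j -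
          (q : ℚ) ^ (m * (j - 1).choose 2) * gaussianBinomial (q ^ m) (n - 1) (j - 1) *
            ∏ s ∈ Finset.Icc 1 (n - 1), ((q : ℚ) ^ m - (q : ℚ) ^ s))) ∧
    whitneySecond (RankMetricLattice K L (n - 1) n) 0 = 1 ∧
    (whitneySecond (RankMetricLattice K L (n - 1) n) 1 : ℚ) =
      gaussianBinomial (q ^ m) n 1 -
        ∏ s ∈ Finset.Icc 1 (n - 1), ((q : ℚ) ^ m - (q : ℚ) ^ s) ∧
    (∀ j : ℕ, 2 ≤ j → j ≤ n →
      (whitneySecond (RankMetricLattice K L (n - 1) n) j : ℚ) =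
        gaussianBinomial (q ^ m) n j) := by
  subst hq hm
  have hn1 : 1 ≤ n := by omega
  have hL : Nat.card L = Nat.card K ^ Module.finrank K L := Module.natCard_eq_pow_finrank
  refine ⟨whitneyFirst_zero, fun j hj _ => ?_, whitneySecond_zero, ?_, fun j hj _ => ?_⟩
  · rw [whitneyFirst_rankMetricLattice hn1 hj, card_isFullRankLine hn1 hnm, hL, Nat.cast_pow,
      pow_mul, pow_mul]
  · rw [whitneySecond_rankMetricLattice hn1, ← card_isFullRankLine hn1 hnm, hL,
      Nat.card_congr (Equiv.subtypeEquivRight fun X => and_iff_right_of_imp fun h =>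
        IsFullRankLine.finrank_eq (K := K) hn1 h)]
  · have : IsEmpty {X : Submodule L (Fin n → L) //
        Module.finrank L X = j ∧ IsFullRankLine K X} :=
      ⟨fun X => by have := X.2.1.symm.trans (X.2.2.finrank_eq hn1); omega⟩
    rw [whitneySecond_rankMetricLattice hn1, hL, Nat.card_of_isEmpty (α := {X : Submodule L (Fin n → L) //
      Module.finrank L X = j ∧ IsFullRankLine K X})]
    simp
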